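/- **Notation.** For a set $X$ let $\beta X$ be the set of ultrafilters over $X$ with its standard compact Hausdorff topology (basic open sets $\{\mathfrak u: A\in\mathfrak u\}$, $A\subseteq X$); points of $X$ are identified with principal ultrafilters. Write $(\forall^{\mathfrak u}x)\,\varphi(x)$ for $\{x:\varphi(x)\}\in\mathfrak u$. For $F:X^n\to X$ and $R\subseteq X^n$ let $$\widetilde F(\mathfrak u_1,\ldots,\mathfrak u_n)=\{S\subseteq X:(\forall^{\mathfrak u_1}x_1)\cdots(\forall^{\mathfrak u_n}x_n)\;F(x_1,\ldots,x_n)\in S\},$$ $$\widetilde R(\mathfrak u_1,\ldots,\mathfrak u_n)\iff(\forall^{\mathfrak u_1}x_1)\cdots(\forall^{\mathfrak u_n}x_n)\;R(x_1,\ldots,x_n),$$ $$R^*(\mathfrak u_1,\ldots,\mathfrak u_n)\iff \text{every } A_1\times\cdots\times A_n \text{ with } A_i\in\mathfrak u_i \text{ meets } R.$$ For a first-order model $\mathfrak A=(X,F,\ldots,R,\ldots)$ let $\widetilde{\mathfrak A}=(\beta X,\widetilde F,\ldots,\widetilde R,\ldots)$ and $\mathfrak A^*=(\beta X,\widetilde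 F,\ldots,R^*,\ldots)$. For a map $h$ of $X$ into a compact Hausdorff space $Y$, $\widetilde h:\beta X\to Y$ is its continuous extension, and $h``X$ is the image of $h$. **Generalized models.** An ultrafilter interpretation over a set $M$ takes each $n$-ary function symbol to an ultrafilter over the set $M^{M^n}$ of $n$-ary operations on $M$, and each $n$-ary predicate symbol to an ultrafilter over $\mathcal P(M^n)$. A *generalized model (in the wide sense)* with universe $M$ is an ultrafilter interpretation over $M$. A *generalized model in the narrow sense* with universe $\beta X$ is an ultrafilter interpretation over $X$. If spaces of operations and of relations on $M$ are fixed (for each $n$, topologies on $M^{M^n}$ and $\mathcal P(M^n)$ together with subspaces in which limits are taken), and each ultrafilter interpreting a symbol in $\mathfrak V$ converges to a unique point of the corresponding subspace, its *limit*, then the ordinary model $\lim\mathfrak V$ with universe $M$ interprets the symbols by these limits. A map is a *homomorphism* of $\mathfrak U$ into $\mathfrak V$ iff $\lim\mathfrak U$ and $\lim\mathfrak V$ exist and it is a homomorphism of $\lim\mathfrak U$ into $\lim\mathfrak V$. An ordinary model is regarded as the generalized model that interprets each symbol by the corresponding principal ultrafilter, and it is the limit of this generalized model. Let $\mathfrak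 B$ be a generalized model in the narrow sense with universe $\beta X$. It is *pseudo-principal on function symbols* iff for each $n$-ary function symbol, interpreted by $\mathfrak f$, and all $a_1,\ldots,a_n\in X$, the ultrafilter $\{S\subseteq X:(\forall^{\mathfrak f}f)\,f(a_1,\ldots,a_n)\in S\}$ is principal. In that case its *principal submodel* is the ordinary model $\mathfrak A$ with universe $X$ in which the value of this symbol at $(a_1,\ldots,a_n)$ is the point generating that ultrafilter, and a predicate symbol interpreted in $\mathfrak B$ by $\mathfrak r$ holds at $(a_1,\ldots,a_n)$ iff $(\forall^{\mathfrak r}R)\,R(a_1,\ldots,a_n)$. The generalized model $I(\mathfrak B)$ with universe $\beta X$ interprets a function symbol by the ultrafilter generated by the sets $\{\widetilde f:f\in A\}$, $A\in\mathfrak f$, and a predicate symbol by the ultrafilter generated by the sets $\{R^*:R\in A\}$, $A\in\mathfrak r$. Limits for $I(\mathfrak B)$ are taken in the set of $n$-ary operations on $\beta X$ right continuous w.r.t. $X$, with the topology of pointwise convergence on $X^n$, and in the set of regular closed subsets of $(\beta X)^n$, with the topology transferred from $2^{X^n}$ by the bijection $R\mapsto R^*$. For a topological space $Y$ and $D\subseteq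 Y$, a map $G:Y^n\to Y$ is *right continuous w.r.t. $D$* iff for each $1\le i\le n$, $d_1,\ldots,d_{i-1}\in D$ and $y_{i+1},\ldots,y_n\in Y$ the map $y\mapsto G(d_1,\ldots,d_{i-1},y,y_{i+1},\ldots,y_n)$ is continuous. **Theorem.** Let $\mathfrak U$ and $\mathfrak V$ be generalized models (in the wide sense) in the same signature with universes $\beta X$ and $Y$, respectively, where $Y$ carries a compact Hausdorff topology and spaces of operations and of relations on $Y$ are fixed, and let $h:X\to Y$. Suppose that (a) $\mathfrak U=I(\mathfrak B)$ for a generalized model $\mathfrak B$ in the narrow sense which is pseudo-principal on function symbols, with $\mathfrak A$ its principal submodel; (b) in $\mathfrak V$, every $n$-ary function symbol is interpreted by an ultrafilter having a limit that is an operation $Y^n\to Y$ right continuous w.r.t. $h``X$, and every $n$-ary predicate symbol is interpreted by an ultrafilter having a limit that is a closed subset of $Y^n$ in the product topology. Then the following are equivalent: (i) $h$ is a homomorphism of $\mathfrak A$ into $\mathfrak V$; (ii) $\widetilde h$ is a homomorphism of $\mathfrak U$ into $\mathfrak V$; (iii) $\widetilde h$ is a homomorphism of $\widetilde{\mathfrak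 A}$ into $\mathfrak V$; (iv) $\widetilde h$ is a homomorphism of $\mathfrak A^*$ into $\mathfrak V$. -/

import Mathlib

open Set Filter Topology
open FirstOrder

universe u v

namespace UltraModel

noncomputable section

/-! ## Ultrafilter extensions of maps and relations

`Ultrafilter X` is the set `βX` of ultrafilters over `X`, with Mathlib's instance of the standard
topology, generated by the sets `{𝔲 | A ∈ 𝔲}`. A point `x : X` is identified with the principal
ultrafilter `pure x`. -/

/-- The ultrafilter over `X ^ n` given by the iterated ultrafilter quantifiers
`(∀^{𝔲₁} x₁) ⋯ (∀^{𝔲ₙ} xₙ)`, see `mem_tensor_zero` and `mem_tensor_succ`. -/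
def tensor {X : Type u} : {n : ℕ} → (Fin n → Ultrafilter X) → Ultrafilter (Fin n → X)
  | 0, _ => pure Fin.elim0
  | _ + 1, 𝔲 => (𝔲 0).bind fun x => (tensor (Fin.tail 𝔲)).map fun y => Fin.cons x y

theorem mem_tensor_zero {X : Type u} (𝔲 : Fin 0 → Ultrafilter X) (A : Set (Fin 0 → X)) :
    A ∈ tensor 𝔲 ↔ (Fin.elim0 : Fin 0 → X) ∈ A :=
  Iff.rfl

theorem mem_tensor_succ {X : Type u} {n : ℕ} (𝔲 : Fin (n + 1) → Ultrafilter X)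
    (A : Set (Fin (n + 1) → X)) :
    A ∈ tensor 𝔲 ↔
      {x : X | {y : Fin n → X | (Fin.cons x y : Fin (n + 1) → X) ∈ A} ∈ tensor (Fin.tail 𝔲)}
        ∈ 𝔲 0 :=
  Iff.rfl

/-- The extension `F̃` of an `n`-ary operation `F`:
`S ∈ F̃(𝔲₁, …, 𝔲ₙ)` iff `(∀^{𝔲₁} x₁) ⋯ (∀^{𝔲ₙ} xₙ) F(x₁, …, xₙ) ∈ S`. -/
def extMap {X : Type u} {n : ℕ} (F : (Fin n → X) → X) (𝔲 : Fin n → Ultrafilter X) :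
    Ultrafilter X :=
  (tensor 𝔲).map F

/-- The smaller extension `R̃` of an `n`-ary relation `R`:
`R̃(𝔲₁, …, 𝔲ₙ)` iff `(∀^{𝔲₁} x₁) ⋯ (∀^{𝔲ₙ} xₙ) R(x₁, …, xₙ)`. -/
def extRel {X : Type u} {n : ℕ} (R : Set (Fin n → X)) : Set (Fin n → Ultrafilter X) :=
  {𝔲 | R ∈ tensor 𝔲}

/-- The larger extension `R*` of an `n`-ary relation `R`: `R*(𝔲₁, …, 𝔲ₙ)` iff every product
`A₁ × ⋯ × Aₙ` with `A₁ ∈ 𝔲₁, …, Aₙ ∈ 𝔲ₙ` meets `R`. -/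
def starRel {X : Type u} {n : ℕ} (R : Set (Fin n → X)) : Set (Fin n → Ultrafilter X) :=
  {𝔲 | ∀ A : Fin n → Set X, (∀ i, A i ∈ 𝔲 i) → ∃ x ∈ R, ∀ i, x i ∈ A i}

/-- The ultrafilter extension `𝔄̃ = (βX, F̃, …, R̃, …)` of a model `𝔄 = (X, F, …, R, …)`. -/
abbrev tildeModel {L : Language} {X : Type u} (𝔄 : L.Structure X) : L.Structure (Ultrafilter X) where
  funMap f := extMap (𝔄.funMap f)
  RelMap R 𝔲 := 𝔲 ∈ extRel {x | 𝔄.RelMap R x}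

/-- The ultrafilter extension `𝔄* = (βX, F̃, …, R*, …)` of a model `𝔄 = (X, F, …, R, …)`. -/
abbrev starModel {L : Language} {X : Type u} (𝔄 : L.Structure X) : L.Structure (Ultrafilter X) where
  funMap f := extMap (𝔄.funMap f)
  RelMap R 𝔲 := 𝔲 ∈ starRel {x | 𝔄.RelMap R x}

/-! ## Generalized models -/

/-- An ultrafilter interpretation of the signature `L` over the set `M`: each `n`-ary function
symbol is taken to an ultrafilter over the `n`-ary operations on `M`, each `n`-ary predicate
symbol to an ultrafilter over the `n`-ary relations on `M`.

A generalized model in the wide sense with the universe `M` is an ultrafilter interpretation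
over `M`. A generalized model in the narrow sense with the universe `βX` is an ultrafilter
interpretation over `X`. -/
structure UltraInterp (L : Language) (M : Type u) where
  funUlt : ∀ {n : ℕ}, L.Functions n → Ultrafilter ((Fin n → M) → M)
  relUlt : ∀ {n : ℕ}, L.Relations n → Ultrafilter (Set (Fin n → M))

/-- The extension to ultrafilters of the application operation `app(x₁, …, xₙ, f) = f(x₁, …, xₙ)`:
`S ∈ app̃(𝔲₁, …, 𝔲ₙ, 𝔣)` iff `(∀^{𝔲₁} x₁) ⋯ (∀^{𝔲ₙ} xₙ) (∀^𝔣 f) f(x₁, …, xₙ) ∈ S`. -/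
def extApp {X : Type u} {n : ℕ} (𝔲 : Fin n → Ultrafilter X)
    (𝔣 : Ultrafilter ((Fin n → X) → X)) : Ultrafilter X :=
  (tensor 𝔲).bind fun x => 𝔣.map fun f => f x

/-- The extension to ultrafilters of the membership predicate `in(x₁, …, xₙ, R)`:
it holds at `(𝔲₁, …, 𝔲ₙ, 𝔯)` iff `(∀^{𝔲₁} x₁) ⋯ (∀^{𝔲ₙ} xₙ) (∀^𝔯 R) R(x₁, …, xₙ)`. -/
def extIn {X : Type u} {n : ℕ} (𝔲 : Fin n → Ultrafilter X)
    (𝔯 : Ultrafilter (Set (Fin n → X))) : Prop :=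
  {x | {R | x ∈ R} ∈ 𝔯} ∈ tensor 𝔲

/-- An ultrafilter over `n`-ary operations on `X` is pseudo-principal iff `app̃` takes every tuple
of principal ultrafilters together with it to a principal ultrafilter. -/
def IsPseudoPrincipal {X : Type u} {n : ℕ} (𝔣 : Ultrafilter ((Fin n → X) → X)) : Prop :=
  ∀ a : Fin n → X, ∃ y : X, extApp (fun i => pure (a i)) 𝔣 = pure y

/-- `𝔄` is the principal submodel of the generalized model `𝔅` in the narrow sense: the submodel
of `𝔅` consisting of the principal ultrafilters, which are identified with the points of `X`. -/
def IsPrincipalSubmodel {L : Language} {X : Type u} (𝔄 : L.Structure X) (𝔅 : UltraInterp L X) :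
    Prop :=
  (∀ (n : ℕ) (f : L.Functions n) (a : Fin n → X),
    extApp (fun i => pure (a i)) (𝔅.funUlt f) = pure (𝔄.funMap f a)) ∧
  ∀ (n : ℕ) (R : L.Relations n) (a : Fin n → X),
    𝔄.RelMap R a ↔ extIn (fun i => pure (a i)) (𝔅.relUlt R)

/-- The map `I`, from generalized models in the narrow sense with the universe `βX` to generalized
models in the wide sense with the universe `βX`. An ultrafilter `𝔣` over the `n`-ary operations
on `X` goes to the ultrafilter over the `n`-ary operations on `βX` generated by the sets
`{f̃ | f ∈ A}` with `A ∈ 𝔣`; an ultrafilter `𝔯` over the `n`-ary relations on `X` goes to the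
ultrafilter over the `n`-ary relations on `βX` generated by the sets `{R* | R ∈ A}`
with `A ∈ 𝔯`. -/
def mapI {L : Language} {X : Type u} (𝔅 : UltraInterp L X) : UltraInterp L (Ultrafilter X) where
  funUlt f := (𝔅.funUlt f).map extMap
  relUlt R := (𝔅.relUlt R).map starRel

/-- An ordinary model regarded as a generalized model in the wide sense: every symbol is
interpreted by a principal ultrafilter. -/
def principalInterp {L : Language} {M : Type u} (𝔄 : L.Structure M) : UltraInterp L M where
  funUlt f := pure (𝔄.funMap f)
  relUlt R := pure {x | 𝔄.RelMap R x}

/-! ## Limits and homomorphisms of generalized models in the wide sense -/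

/-- The spaces in which limits of ultrafilters over `n`-ary operations and over `n`-ary relations
on `M` are taken: for each `n`, topologies on the sets of all `n`-ary operations and relations,
and the subspaces in which limits are sought. -/
structure LimitSpaces (M : Type u) where
  funTop : ∀ n : ℕ, TopologicalSpace ((Fin n → M) → M)
  funSpace : ∀ n : ℕ, Set ((Fin n → M) → M)
  relTop : ∀ n : ℕ, TopologicalSpace (Set (Fin n → M))
  relSpace : ∀ n : ℕ, Set (Set (Fin n → M))

/-- `z` is the limit of `𝔷` in the subspace `S`: the unique point of `S` to which `𝔷` converges. -/
def IsLimitIn {Z : Type u} (τ : TopologicalSpace Z) (S : Set Z) (𝔷 : Ultrafilter Z) (z : Z) :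
    Prop :=
  z ∈ S ∧ (𝔷 : Filter Z) ≤ @nhds Z τ z ∧ ∀ w ∈ S, (𝔷 : Filter Z) ≤ @nhds Z τ w → w = z

/-- `𝔄 = lim 𝔘`. -/
def IsLimitModel {L : Language} {M : Type u} (T : LimitSpaces M) (𝔘 : UltraInterp L M)
    (𝔄 : L.Structure M) : Prop :=
  (∀ (n : ℕ) (f : L.Functions n),
    IsLimitIn (T.funTop n) (T.funSpace n) (𝔘.funUlt f) (𝔄.funMap f)) ∧
  ∀ (n : ℕ) (R : L.Relations n),
    IsLimitIn (T.relTop n) (T.relSpace n) (𝔘.relUlt R) {x | 𝔄.RelMap R x}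

/-- `g` is a homomorphism of the generalized model `𝔘` into the generalized model `𝔙`: both models
have limits, and `g` is a homomorphism of `lim 𝔘` into `lim 𝔙`. -/
def IsGenHom {L : Language} {M : Type u} {N : Type v} (S : LimitSpaces M) (𝔘 : UltraInterp L M)
    (T : LimitSpaces N) (𝔙 : UltraInterp L N) (g : M → N) : Prop :=
  ∃ (𝔄 : L.Structure M) (ℭ : L.Structure N), IsLimitModel S 𝔘 𝔄 ∧ IsLimitModel T 𝔙 ℭ ∧
    ∃ φ : @Language.Hom L M N 𝔄 ℭ, φ.toFun = g

/-- Discrete topologies on all operations and relations. An ordinary model is the limit of the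
generalized model that it induces. -/
def discreteSpaces (M : Type u) : LimitSpaces M where
  funTop _ := ⊥
  funSpace _ := univ
  relTop _ := ⊥
  relSpace _ := univ

/-- An `n`-ary map `F` on `M` is right continuous w.r.t. `A`: it is continuous in its `i`-th
argument whenever the arguments before the `i`-th lie in `A`. The set of these maps
is `RC_A(Mⁿ, N)`. -/
def RightContinuous {M : Type u} {N : Type v} [TopologicalSpace M] [TopologicalSpace N] {n : ℕ}
    (A : Set M) (F : (Fin n → M) → N) : Prop :=
  ∀ (i : Fin n) (x : Fin n → M), (∀ j, j < i → x j ∈ A) →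
    Continuous fun t : M => F (Function.update x i t)

/-- `Q` is the closure of an open set. -/
def IsRegularClosed {Z : Type u} [TopologicalSpace Z] (Q : Set Z) : Prop :=
  ∃ U : Set Z, IsOpen U ∧ Q = closure U

/-- The topology on the subsets of `Z` that is the product topology on `2 ^ Z`, with `2`
discrete. -/
abbrev powersetTopology (Z : Type u) : TopologicalSpace (Set Z) :=
  ⨅ z : Z, TopologicalSpace.induced (fun S : Set Z => z ∈ S) ⊥

/-- The spaces in which the limit of `I(𝔅)` is taken: the right continuous operations on `βX`
w.r.t. `X` with the topology of pointwise convergence on `X ^ n`, and the regular closed relations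
on `βX` with the topology transferred from `2 ^ (X ^ n)` along the bijection `R ↦ R*`. -/
def standardSpaces (X : Type u) : LimitSpaces (Ultrafilter X) where
  funTop n := TopologicalSpace.induced
    (fun (G : (Fin n → Ultrafilter X) → Ultrafilter X) (a : Fin n → X) => G fun i => pure (a i))
    Pi.topologicalSpace
  funSpace _ := {G | RightContinuous (range (pure : X → Ultrafilter X)) G}
  relTop n := TopologicalSpace.coinduced starRel (powersetTopology (Fin n → X))
  relSpace _ := {Q | IsRegularClosed Q}

end

end UltraModel

namespace UltraModel

/-! The tuples of principal ultrafilters are dense in `(βX)ⁿ`. A map that is right continuous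
w.r.t. a dense set is determined by its values on the tuples from this set, so an identity
between right continuous maps has to be checked on `Xⁿ` only. Similarly, `R*` is the closure
of `R`, so a continuous map that takes `R` into a closed set takes `R*` into it as well. This
extends homomorphisms from `𝔄` to `𝔄*`; conversely, `X` embeds into `𝔄̃`, and `R̃ ⊆ R*`.

The same density arguments identify `𝔄*` as the limit of `I(𝔅)`: convergence in the spaces used
for `I(𝔅)` is tested on tuples from `X`, where `𝔄` records the values of `𝔅`, and a right
continuous operation or a regular closed relation is determined by its restriction to `X`. -/

section RightContinuous

variable {M N : Type*} [TopologicalSpace M] [TopologicalSpace N] {n : ℕ}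

theorem RightContinuous.continuous_comp {P : Type*} [TopologicalSpace P] {A : Set M}
    {F : (Fin n → M) → N} {g : N → P} (hF : RightContinuous A F) (hg : Continuous g) :
    RightContinuous A (g ∘ F) :=
  fun i x hx => hg.comp (hF i x hx)

theorem RightContinuous.comp_continuous {P : Type*} [TopologicalSpace P] {A : Set M} {B : Set P}
    {F : (Fin n → P) → N} {g : M → P} (hF : RightContinuous B F) (hg : Continuous g)
    (hAB : MapsTo g A B) : RightContinuous A fun x => F (g ∘ x) := by
  intro i x hx
  simp only [Function.comp_update]
  exact (hF i (g ∘ x) fun j hj => hAB (hx j hj)).comp hg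

theorem RightContinuous.ext_of_denseRange [T2Space N] {D : Type*} {e : D → M} (he : DenseRange e)
    {F G : (Fin n → M) → N} (hF : RightContinuous (range e) F) (hG : RightContinuous (range e) G)
    (hFG : ∀ a : Fin n → D, F (e ∘ a) = G (e ∘ a)) : F = G := by
  -- Free the arguments from the last one to the first: right continuity in the `k`-th argument
  -- needs the arguments before it, but not those after it, to lie in the dense set.
  have eq_of_initial_mem : ∀ k ≤ n, ∀ x : Fin n → M,
      (∀ i : Fin n, (i : ℕ) < k → x i ∈ range e) → F x = G x := by
    intro k hk
    induction hk using Nat.decreasingInduction with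
    | self =>
      intro x hx
      choose a ha using fun i : Fin n => hx i i.isLt
      rw [← show e ∘ a = x from funext ha, hFG]
    | of_succ k hk ih =>
      intro x hx
      let i : Fin n := ⟨k, hk⟩
      have eq_on_dense : EqOn (fun t => F (Function.update x i t))
          (fun t => G (Function.update x i t)) (range e) := by
        intro t ht
        refine ih _ fun j hj => ?_
        obtain rfl | hne := eq_or_ne j i
        · rwa [Function.update_self]
        · rw [Function.update_of_ne hne]
          exact hx j (lt_of_le_of_ne (Nat.lt_succ_iff.1 hj) fun h => hne (Fin.ext h))
      simpa using congrFun (Continuous.ext_on he (hF i x hx) (hG i x hx) eq_on_dense) (x i)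
  exact funext fun x => eq_of_initial_mem 0 n.zero_le x fun i hi => absurd hi (Nat.not_lt_zero _)

end RightContinuous

section Ultrafilter

theorem continuous_ultrafilter_bind {X : Type u} {Z : Type v} (g : X → Ultrafilter Z) :
    Continuous fun 𝔲 : Ultrafilter X => 𝔲.bind g :=
  ultrafilterBasis_is_basis.continuous_iff.2 <| by
    rintro _ ⟨A, rfl⟩
    exact ultrafilter_isOpen_basic {x | A ∈ g x}

theorem continuous_ultrafilter_map {X : Type u} {Z : Type v} (g : X → Z) :
    Continuous (Ultrafilter.map g) :=
  continuous_ultrafilter_bind fun x => pure (g x)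

theorem tendsto_pure_comp_nhds_iff {ι : Type u} {X : Type v} {𝔷 : Ultrafilter ι} {g : ι → X}
    {𝔲 : Ultrafilter X} :
    Tendsto (fun i => (pure (g i) : Ultrafilter X)) 𝔷 (𝓝 𝔲) ↔ 𝔲 = 𝔷.map g :=
  ultrafilter_converges_iff (u := 𝔷.map fun i => pure (g i))

theorem comap_pure_nhds {X : Type u} (𝔲 : Ultrafilter X) :
    comap pure (𝓝 𝔲) = (𝔲 : Filter X) :=
  𝔲.unique (ultrafilter_comap_pure_nhds 𝔲)
    (@IsDenseInducing.comap_nhds_neBot _ _ ⊥ _ _ isDenseInducing_pure 𝔲)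

theorem isOpen_singleton_pure {X : Type u} (x : X) : IsOpen {(pure x : Ultrafilter X)} := by
  convert ultrafilter_isOpen_basic {x} using 1
  ext 𝔲
  rw [mem_singleton_iff, ← Ultrafilter.coe_le_coe, Ultrafilter.coe_pure, le_pure_iff]
  rfl

end Ultrafilter

section PurePi

/-- The embedding of `X ^ ι` into `(βX) ^ ι` that identifies the points of `X` with the principal
ultrafilters. -/
abbrev purePi {ι : Type*} {X : Type u} (a : ι → X) : ι → Ultrafilter X :=
  pure ∘ a

variable {ι : Type*} {X : Type u}

theorem extend_comp_purePi {Y : Type v} [TopologicalSpace Y] [T2Space Y] (h : X → Y) (a : ι → X) :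
    Ultrafilter.extend h ∘ purePi a = h ∘ a := by
  rw [purePi, ← Function.comp_assoc, ultrafilter_extend_extends]

theorem denseRange_purePi : DenseRange (purePi : (ι → X) → ι → Ultrafilter X) :=
  DenseRange.piMap fun _ => denseRange_pure

theorem comap_purePi_nhds (𝔲 : ι → Ultrafilter X) :
    comap purePi (𝓝 𝔲) = Filter.pi fun i => (𝔲 i : Filter X) := by
  simp only [nhds_pi, ← comap_pure_nhds]
  exact (pi_comap (f := fun _ => pure)).symm

theorem isOpen_image_purePi [Finite ι] (R : Set (ι → X)) : IsOpen (purePi '' R) := by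
  rw [← biUnion_of_singleton (purePi '' R), biUnion_image]
  refine isOpen_biUnion fun a _ => ?_
  rw [← univ_pi_singleton]
  exact isOpen_set_pi finite_univ fun i _ => isOpen_singleton_pure (a i)

end PurePi

section Tensor

variable {X : Type u} {n : ℕ}

theorem tensor_cons_pure (a : X) (𝔲 : Fin n → Ultrafilter X) :
    tensor (Fin.cons (pure a) 𝔲 : Fin (n + 1) → Ultrafilter X) =
      (tensor 𝔲).map fun y => Fin.cons a y :=
  rfl

theorem tensor_purePi (a : Fin n → X) : tensor (purePi a) = pure a := by
  induction n with
  | zero => rw [Subsingleton.elim a Fin.elim0]; rfl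
  | succ n ih =>
    have purePi_eq_cons : purePi a = Fin.cons (pure (a 0)) (purePi (Fin.tail a)) :=
      (Fin.cons_self_tail (purePi a)).symm
    rw [purePi_eq_cons, tensor_cons_pure, ih, Ultrafilter.map_pure, Fin.cons_self_tail]

theorem tensor_le_pi (𝔲 : Fin n → Ultrafilter X) :
    (tensor 𝔲 : Filter (Fin n → X)) ≤ Filter.pi fun i => (𝔲 i : Filter X) := by
  rw [le_pi]
  induction n with
  | zero => exact fun i => i.elim0
  | succ n ih =>
    intro i A hA
    change {x | {y | (Fin.cons x y : Fin (n + 1) → X) i ∈ A} ∈ tensor (Fin.tail 𝔲)} ∈ 𝔲 0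
    cases i using Fin.cases with
    | zero =>
      filter_upwards [hA] with x hx
      exact univ_mem' fun _ => hx
    | succ j =>
      simp only [Fin.cons_succ]
      exact univ_mem' fun _ => ih (Fin.tail 𝔲) j hA

theorem rightContinuous_tensor :
    RightContinuous (range pure) (tensor : (Fin n → Ultrafilter X) → Ultrafilter (Fin n → X)) := by
  induction n with
  | zero => exact fun i => i.elim0
  | succ n ih =>
    intro i 𝔲 h𝔲
    cases i using Fin.cases with
    | zero =>
      simp only [tensor, Function.update_self, Fin.tail_update_zero]
      exact continuous_ultrafilter_bind _
    | succ j =>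
      obtain ⟨a, ha⟩ := h𝔲 0 j.succ_pos
      have tensor_update : ∀ 𝔱, tensor (Function.update 𝔲 j.succ 𝔱) =
          (tensor (Function.update (Fin.tail 𝔲) j 𝔱)).map fun y => Fin.cons a y := by
        intro 𝔱
        rw [← tensor_cons_pure, ha, Fin.cons_update, Fin.cons_self_tail]
      simp only [tensor_update]
      exact (continuous_ultrafilter_map _).comp
        (ih j (Fin.tail 𝔲) fun k hk => h𝔲 k.succ (Fin.succ_lt_succ_iff.2 hk))

theorem extMap_purePi (F : (Fin n → X) → X) (a : Fin n → X) :
    extMap F (purePi a) = pure (F a) := by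
  rw [extMap, tensor_purePi, Ultrafilter.map_pure]

theorem rightContinuous_extMap (F : (Fin n → X) → X) :
    RightContinuous (range pure) (extMap F) :=
  rightContinuous_tensor.continuous_comp (continuous_ultrafilter_map F)

theorem extApp_purePi (a : Fin n → X) (𝔣 : Ultrafilter ((Fin n → X) → X)) :
    extApp (purePi a) 𝔣 = 𝔣.map fun f => f a := by
  rw [extApp, tensor_purePi]
  rfl

theorem extIn_purePi (a : Fin n → X) (𝔯 : Ultrafilter (Set (Fin n → X))) :
    extIn (purePi a) 𝔯 ↔ {R | a ∈ R} ∈ 𝔯 := by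
  rw [extIn, tensor_purePi]
  rfl

theorem purePi_mem_extRel {R : Set (Fin n → X)} {a : Fin n → X} : purePi a ∈ extRel R ↔ a ∈ R := by
  rw [extRel, mem_ofPred_eq, tensor_purePi, Ultrafilter.mem_pure]

end Tensor

section StarRel

variable {X : Type u} {n : ℕ}

theorem mem_starRel_iff_frequently {R : Set (Fin n → X)} {𝔲 : Fin n → Ultrafilter X} :
    𝔲 ∈ starRel R ↔ ∃ᶠ x in Filter.pi fun i => (𝔲 i : Filter X), x ∈ R := by
  rw [frequently_iff]
  constructor
  · intro h𝔲 U hU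
    obtain ⟨I, A, hA, hAU⟩ := mem_pi'.1 hU
    obtain ⟨x, hxR, hxA⟩ := h𝔲 A hA
    exact ⟨x, hAU fun i _ => hxA i, hxR⟩
  · intro h𝔲 A hA
    obtain ⟨x, hxA, hxR⟩ := h𝔲 (eventually_pi hA)
    exact ⟨x, hxR, hxA⟩

theorem purePi_mem_starRel {R : Set (Fin n → X)} {a : Fin n → X} :
    purePi a ∈ starRel R ↔ a ∈ R := by
  rw [mem_starRel_iff_frequently]
  simp only [Function.comp_apply, Ultrafilter.coe_pure, pi_pure, frequently_pure]

theorem starRel_injective :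
    Function.Injective (starRel : Set (Fin n → X) → Set (Fin n → Ultrafilter X)) := by
  intro R S hRS
  ext a
  rw [← purePi_mem_starRel, hRS, purePi_mem_starRel]

theorem extRel_subset_starRel (R : Set (Fin n → X)) : extRel R ⊆ starRel R := fun 𝔲 h𝔲 =>
  mem_starRel_iff_frequently.2 ((Eventually.frequently h𝔲).filter_mono (tensor_le_pi 𝔲))

theorem starRel_eq_closure (R : Set (Fin n → X)) : starRel R = closure (purePi '' R) := by
  ext 𝔲
  rw [mem_starRel_iff_frequently, ← comap_purePi_nhds, frequently_comap,
    mem_closure_iff_frequently]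
  simp only [mem_image, and_comm]

theorem range_starRel :
    range (starRel : Set (Fin n → X) → Set (Fin n → Ultrafilter X)) = {Q | IsRegularClosed Q} := by
  refine Subset.antisymm ?_ ?_
  · rintro _ ⟨R, rfl⟩
    exact ⟨_, isOpen_image_purePi R, starRel_eq_closure R⟩
  · rintro _ ⟨U, hU, rfl⟩
    refine ⟨purePi ⁻¹' U, ?_⟩
    rw [starRel_eq_closure]
    exact Subset.antisymm (closure_mono (image_preimage_subset _ _))
      (closure_minimal (denseRange_purePi.subset_closure_image_preimage_of_isOpen hU)
        isClosed_closure)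

end StarRel

section Limits

theorem isInducing_coinduced_of_injective {Z W : Type*} [τ : TopologicalSpace Z] {s : Z → W}
    (hs : Function.Injective s) : @IsInducing Z W τ (τ.coinduced s) s :=
  letI := τ.coinduced s
  ⟨le_antisymm continuous_coinduced_rng.le_induced fun U hU =>
    ⟨s '' U, by rwa [isOpen_coinduced, hs.preimage_image], hs.preimage_image U⟩⟩

theorem le_nhds_powersetTopology_iff {Z : Type u} {𝔷 : Ultrafilter (Set Z)} {S : Set Z} :
    (𝔷 : Filter (Set Z)) ≤ @nhds _ (powersetTopology Z) S ↔ S = {z | {R | z ∈ R} ∈ 𝔷} := by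
  rw [powersetTopology, nhds_iInf, le_iInf_iff, Set.ext_iff]
  refine forall_congr' fun z => ?_
  have nhds_bot : @nhds Prop ⊥ = pure := @nhds_discrete Prop ⊥ (@DiscreteTopology.mk Prop ⊥ rfl)
  rw [@nhds_induced _ _ ⊥, ← tendsto_iff_comap, nhds_bot, tendsto_pure]
  by_cases hz : z ∈ S
  · simp only [hz, eq_iff_iff, iff_true, true_iff]
    rfl
  · simp only [hz, eq_iff_iff, iff_false, false_iff]
    exact Ultrafilter.eventually_not

theorem isLimitIn_pure_discrete {Z : Type u} (z : Z) : IsLimitIn ⊥ univ (pure z) z := by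
  let _ : TopologicalSpace Z := ⊥
  have : DiscreteTopology Z := ⟨rfl⟩
  refine ⟨mem_univ z, pure_le_nhds z, fun w _ hw => ?_⟩
  rw [nhds_discrete] at hw
  exact (Ultrafilter.mem_pure.1 (le_pure_iff.1 hw)).symm

theorem IsLimitIn.unique {Z : Type u} {τ : TopologicalSpace Z} {S : Set Z} {𝔷 : Ultrafilter Z}
    {z w : Z} (hz : IsLimitIn τ S 𝔷 z) (hw : IsLimitIn τ S 𝔷 w) : z = w :=
  hw.2.2 z hz.1 hz.2.1

variable {X : Type u} {n : ℕ}

theorem map_extMap_le_nhds_iff {𝔣 : Ultrafilter ((Fin n → X) → X)}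
    {G : (Fin n → Ultrafilter X) → Ultrafilter X} :
    ((𝔣.map extMap : Ultrafilter _) : Filter _) ≤ @nhds _ ((standardSpaces X).funTop n) G ↔
      ∀ a, G (purePi a) = extApp (purePi a) 𝔣 := by
  rw [standardSpaces, nhds_induced, ← tendsto_iff_comap, Ultrafilter.coe_map, tendsto_map'_iff,
    tendsto_pi_nhds]
  refine forall_congr' fun a => ?_
  rw [extApp_purePi, ← tendsto_pure_comp_nhds_iff]
  simp only [← extMap_purePi]
  rfl

theorem map_starRel_le_nhds_iff {𝔯 : Ultrafilter (Set (Fin n → X))} {S : Set (Fin n → X)} :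
    ((𝔯.map starRel : Ultrafilter _) : Filter _) ≤
        @nhds _ ((standardSpaces X).relTop n) (starRel S) ↔
      S = {a | extIn (purePi a) 𝔯} := by
  let _ := powersetTopology (Fin n → X)
  let _ := (standardSpaces X).relTop n
  simp only [extIn_purePi]
  rw [← le_nhds_powersetTopology_iff]
  exact ((isInducing_coinduced_of_injective starRel_injective).tendsto_nhds_iff (f := id)).symm

theorem isLimitIn_map_extMap {𝔣 : Ultrafilter ((Fin n → X) → X)} {F : (Fin n → X) → X}
    (hF : ∀ a, extApp (purePi a) 𝔣 = pure (F a)) :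
    IsLimitIn ((standardSpaces X).funTop n) ((standardSpaces X).funSpace n) (𝔣.map extMap)
      (extMap F) := by
  refine ⟨rightContinuous_extMap F, map_extMap_le_nhds_iff.2 fun a => ?_, fun G hG hlim => ?_⟩
  · rw [extMap_purePi, hF]
  · refine RightContinuous.ext_of_denseRange denseRange_pure hG (rightContinuous_extMap F)
      fun a => ?_
    rw [map_extMap_le_nhds_iff.1 hlim a, hF, extMap_purePi]

theorem isLimitIn_map_starRel (𝔯 : Ultrafilter (Set (Fin n → X))) :
    IsLimitIn ((standardSpaces X).relTop n) ((standardSpaces X).relSpace n) (𝔯.map starRel)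
      (starRel {a | extIn (purePi a) 𝔯}) := by
  refine ⟨range_starRel.subset (mem_range_self _), map_starRel_le_nhds_iff.2 rfl,
    fun Q hQ hlim => ?_⟩
  obtain ⟨S, rfl⟩ := range_starRel.superset hQ
  rw [map_starRel_le_nhds_iff.1 hlim]

theorem IsLimitModel.unique {L : Language} {M : Type u} {T : LimitSpaces M} {𝔘 : UltraInterp L M}
    {𝔄 ℭ : L.Structure M} (h𝔄 : IsLimitModel T 𝔘 𝔄) (hℭ : IsLimitModel T 𝔘 ℭ) : 𝔄 = ℭ := by
  ext n s x
  · exact congrFun ((h𝔄.1 n s).unique (hℭ.1 n s)) x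
  · exact Set.ext_iff.1 ((h𝔄.2 n s).unique (hℭ.2 n s)) x

theorem isLimitModel_principalInterp {L : Language} {M : Type u} (𝔄 : L.Structure M) :
    IsLimitModel (discreteSpaces M) (principalInterp 𝔄) 𝔄 :=
  ⟨fun _ f => isLimitIn_pure_discrete (𝔄.funMap f),
    fun _ R => isLimitIn_pure_discrete {x | 𝔄.RelMap R x}⟩

theorem isLimitModel_mapI {L : Language} {𝔄 : L.Structure X} {𝔅 : UltraInterp L X}
    (h𝔄 : IsPrincipalSubmodel 𝔄 𝔅) :
    IsLimitModel (standardSpaces X) (mapI 𝔅) (starModel 𝔄) := by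
  refine ⟨fun n f => isLimitIn_map_extMap (h𝔄.1 n f), fun n R => ?_⟩
  have relMap_eq : {a | 𝔄.RelMap R a} = {a | extIn (purePi a) (𝔅.relUlt R)} := Set.ext (h𝔄.2 n R)
  change IsLimitIn _ _ _ (starRel {a | 𝔄.RelMap R a})
  rw [relMap_eq]
  exact isLimitIn_map_starRel (𝔅.relUlt R)

end Limits

section Hom

/-- `g` is a homomorphism of `𝔄` into `ℭ`, as a property of the map `g`. Unlike in
`FirstOrder.Language.Hom`, the structures are explicit arguments, so that several of them on the
same universe can be compared. -/
structure IsHom {L : Language} {M N : Type*} (𝔄 : L.Structure M) (ℭ : L.Structure N)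
    (g : M → N) : Prop where
  map_funMap : ∀ {n : ℕ} (f : L.Functions n) (x : Fin n → M),
    g (𝔄.funMap f x) = ℭ.funMap f (g ∘ x)
  map_relMap : ∀ {n : ℕ} (R : L.Relations n) (x : Fin n → M), 𝔄.RelMap R x → ℭ.RelMap R (g ∘ x)

variable {L : Language}

theorem IsHom.comp {M N P : Type*} {𝔄 : L.Structure M} {𝔇 : L.Structure N} {ℭ : L.Structure P}
    {g : N → P} {h : M → N} (hg : IsHom 𝔇 ℭ g) (hh : IsHom 𝔄 𝔇 h) : IsHom 𝔄 ℭ (g ∘ h) where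
  map_funMap f x := by rw [Function.comp_apply, hh.map_funMap, hg.map_funMap, Function.comp_assoc]
  map_relMap R x hx := hg.map_relMap R (h ∘ x) (hh.map_relMap R x hx)

theorem isGenHom_iff_isHom {M : Type u} {N : Type v} {S : LimitSpaces M} {𝔘 : UltraInterp L M}
    {T : LimitSpaces N} {𝔙 : UltraInterp L N} {𝔄 : L.Structure M} {ℭ : L.Structure N}
    (h𝔄 : IsLimitModel S 𝔘 𝔄) (hℭ : IsLimitModel T 𝔙 ℭ) (g : M → N) :
    IsGenHom S 𝔘 T 𝔙 g ↔ IsHom 𝔄 ℭ g := by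
  constructor
  · rintro ⟨𝔄', ℭ', h𝔄', hℭ', φ, rfl⟩
    obtain rfl : 𝔄' = 𝔄 := h𝔄'.unique h𝔄
    obtain rfl : ℭ' = ℭ := hℭ'.unique hℭ
    exact ⟨φ.map_fun', φ.map_rel'⟩
  · exact fun hg => ⟨𝔄, ℭ, h𝔄, hℭ, @Language.Hom.mk L M N 𝔄 ℭ g hg.map_funMap hg.map_relMap, rfl⟩

variable {X : Type u} {Y : Type v} [TopologicalSpace Y] [T2Space Y] {n : ℕ}

theorem isHom_pure_tildeModel (𝔄 : L.Structure X) : IsHom 𝔄 (tildeModel 𝔄) pure where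
  map_funMap f a := (extMap_purePi (𝔄.funMap f) a).symm
  map_relMap _ _ ha := purePi_mem_extRel.2 ha

theorem isHom_id_tildeModel_starModel (𝔄 : L.Structure X) :
    IsHom (tildeModel 𝔄) (starModel 𝔄) id where
  map_funMap _ _ := rfl
  map_relMap _ _ h𝔲 := extRel_subset_starRel _ h𝔲

theorem IsHom.of_extend {𝔄 : L.Structure X} {ℭ : L.Structure Y} {h : X → Y}
    (hh : IsHom (tildeModel 𝔄) ℭ (Ultrafilter.extend h)) : IsHom 𝔄 ℭ h := by
  simpa only [ultrafilter_extend_extends] using hh.comp (isHom_pure_tildeModel 𝔄)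

variable [CompactSpace Y]

theorem extend_extMap {h : X → Y} {F : (Fin n → X) → X} {G : (Fin n → Y) → Y}
    (hG : RightContinuous (range h) G) (hFG : ∀ a, h (F a) = G (h ∘ a))
    (𝔲 : Fin n → Ultrafilter X) :
    Ultrafilter.extend h (extMap F 𝔲) = G (Ultrafilter.extend h ∘ 𝔲) := by
  have hcont : Continuous (Ultrafilter.extend h) := continuous_ultrafilter_extend h
  have maps_principal : MapsTo (Ultrafilter.extend h) (range pure) (range h) := by
    rintro _ ⟨x, rfl⟩
    exact ⟨x, (ultrafilter_extend_pure h x).symm⟩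
  refine congrFun (RightContinuous.ext_of_denseRange denseRange_pure
    ((rightContinuous_extMap F).continuous_comp hcont)
    (hG.comp_continuous hcont maps_principal) fun a => ?_) 𝔲
  rw [Function.comp_apply, extMap_purePi, ultrafilter_extend_pure, hFG, extend_comp_purePi]

theorem extend_comp_mem_of_mem_starRel {h : X → Y} {R : Set (Fin n → X)} {S : Set (Fin n → Y)}
    (hS : IsClosed S) (hRS : ∀ a ∈ R, h ∘ a ∈ S) {𝔲 : Fin n → Ultrafilter X}
    (h𝔲 : 𝔲 ∈ starRel R) : Ultrafilter.extend h ∘ 𝔲 ∈ S := by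
  have hcont : Continuous fun 𝔲 : Fin n → Ultrafilter X => Ultrafilter.extend h ∘ 𝔲 :=
    Continuous.piMap fun _ => continuous_ultrafilter_extend h
  have maps_R : MapsTo (Ultrafilter.extend h ∘ ·) (purePi '' R) S := by
    rintro _ ⟨a, ha, rfl⟩
    simpa only [extend_comp_purePi] using hRS a ha
  rw [starRel_eq_closure] at h𝔲
  exact closure_minimal maps_R (hS.preimage hcont) h𝔲

theorem IsHom.extend_starModel {𝔄 : L.Structure X} {ℭ : L.Structure Y} {h : X → Y}
    (hh : IsHom 𝔄 ℭ h)
    (hfun : ∀ (n : ℕ) (f : L.Functions n), RightContinuous (range h) (ℭ.funMap f))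
    (hrel : ∀ (n : ℕ) (R : L.Relations n), IsClosed {y | ℭ.RelMap R y}) :
    IsHom (starModel 𝔄) ℭ (Ultrafilter.extend h) where
  map_funMap f 𝔲 := extend_extMap (hfun _ f) (hh.map_funMap f) 𝔲
  map_relMap R _ h𝔲 := extend_comp_mem_of_mem_starRel (hrel _ R) (hh.map_relMap R) h𝔲

end Hom

end UltraModel

theorem mainTheorem2 {L : FirstOrder.Language} {X : Type u} {Y : Type v}
    [TopologicalSpace Y] [CompactSpace Y] [T2Space Y]
    (𝔘 : UltraModel.UltraInterp L (Ultrafilter X))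
    (𝔙 : UltraModel.UltraInterp L Y) (T : UltraModel.LimitSpaces Y)
    (h : X → Y)
    -- `𝔘 = I(𝔅)`, with `𝔅` pseudo-principal on function symbols and `𝔄` its principal submodel
    (𝔅 : UltraModel.UltraInterp L X) (h𝔘 : 𝔘 = UltraModel.mapI 𝔅)
    (h𝔅 : ∀ (n : ℕ) (f : L.Functions n), UltraModel.IsPseudoPrincipal (𝔅.funUlt f))
    (𝔄 : L.Structure X) (h𝔄 : UltraModel.IsPrincipalSubmodel 𝔄 𝔅)
    -- the limits of the interpretations of the symbols in `𝔙`
    (hfun : ∀ (n : ℕ) (f : L.Functions n), ∃ G : (Fin n → Y) → Y,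
      UltraModel.IsLimitIn (T.funTop n) (T.funSpace n) (𝔙.funUlt f) G ∧
        UltraModel.RightContinuous (Set.range h) G)
    (hrel : ∀ (n : ℕ) (R : L.Relations n), ∃ S : Set (Fin n → Y),
      UltraModel.IsLimitIn (T.relTop n) (T.relSpace n) (𝔙.relUlt R) S ∧ IsClosed S) :
    List.TFAE [
      UltraModel.IsGenHom (UltraModel.discreteSpaces X) (UltraModel.principalInterp 𝔄) T 𝔙 h,
      UltraModel.IsGenHom (UltraModel.standardSpaces X) 𝔘 T 𝔙 (Ultrafilter.extend h),
      UltraModel.IsGenHom (UltraModel.discreteSpaces (Ultrafilter X))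
        (UltraModel.principalInterp (UltraModel.tildeModel 𝔄)) T 𝔙 (Ultrafilter.extend h),
      UltraModel.IsGenHom (UltraModel.discreteSpaces (Ultrafilter X))
        (UltraModel.principalInterp (UltraModel.starModel 𝔄)) T 𝔙 (Ultrafilter.extend h)] := by
  open UltraModel in
  subst h𝔘
  choose G hG hGcont using hfun
  choose S hS hSclosed using hrel
  let ℭ : L.Structure Y := ⟨fun f => G _ f, fun R y => y ∈ S _ R⟩
  have hℭ : IsLimitModel T 𝔙 ℭ := ⟨hG, hS⟩
  rw [isGenHom_iff_isHom (isLimitModel_principalInterp 𝔄) hℭ,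
    isGenHom_iff_isHom (isLimitModel_mapI h𝔄) hℭ,
    isGenHom_iff_isHom (isLimitModel_principalInterp (tildeModel 𝔄)) hℭ,
    isGenHom_iff_isHom (isLimitModel_principalInterp (starModel 𝔄)) hℭ]
  tfae_have 1 → 2 := fun hh => hh.extend_starModel hGcont hSclosed
  tfae_have 2 → 4 := id
  tfae_have 4 → 3 := fun hh => hh.comp (isHom_id_tildeModel_starModel 𝔄)
  tfae_have 3 → 1 := IsHom.of_extend
  tfae_finish
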